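/- Let $X$ and $Y$ be Polish spaces, let $c:X\times Y\to[0,\infty)$ be continuous, and let $c_X:X\to\mathbb R$, $c_Y:Y\to\mathbb R$ satisfy $c(x,y)\le c_X(x)+c_Y(y)$ for all $x,y$. Write $\mathscr P_c(X)$ (resp. $\mathscr P_c(Y)$) for the Borel probability measures on $X$ (resp. $Y$) for which $c_X$ (resp. $c_Y$) is integrable. An optimal coupling of $\mu$ and $\nu$ is a measure $\gamma$ on $X\times Y$ with marginals $\mu,\nu$ that attains the infimum $C(\mu,\nu)$ of $\int c\,d\gamma'$ over all couplings $\gamma'$ of $\mu$ and $\nu$. A set $\Gamma\subset X\times Y$ is $c$-cyclically monotone if $\sum_{i=1}^N c(x_i,y_i)\le\sum_{i=1}^N c(x_i,y_{\sigma(i)})$ for all $N$, all $(x_1,y_1),\dots,(x_N,y_N)\in\Gamma$ and all permutations $\sigma$. The $X$-support of a measure on $X\times Y$ is the (topological) support of its first marginal. For a Markov kernel $K$ from $X$ to $Y$ and a measure $\eta$ on $X$, let $\eta\odot K$ be the measure $\eta(dx)K(x,dy)$ on $X\times Y$ and let $\eta K$ be its second marginal. **Theorem.** Let $\gamma_1$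 and $\gamma_2$ be optimal couplings of their respective marginals, which lie in $\mathscr P_c(X)$ and $\mathscr P_c(Y)$, and let $\gamma_1$ and $\gamma_2$ be $c$-CM compatible, that is, $\operatorname{supp}(\gamma_1)\cup\operatorname{supp}(\gamma_2)$ is $c$-cyclically monotone. Suppose that $$\gamma_1(dx,dy)=a\,\pi_1(dx,dy)+f(x)\,\pi_2(dx,dy),\qquad \gamma_2(dx,dy)=g(x)\,\pi_2(dx,dy)+b\,\pi_3(dx,dy),$$ where $\pi_1,\pi_2,\pi_3$ are Borel probability measures on $X\times Y$ with mutually disjoint $X$-supports, $a,b\ge0$ are constants, and $f,g:X\to[0,\infty)$ are measurable functions that vanish outside the $X$-support of $\pi_2$. Then there exist a Markov kernel $K$ from $X$ to $Y$, a measure $\mu_0\in\mathscr P_c(X)$, and measures $\mu_1,\mu_2\in\mathscr P_c(X)$ that are absolutely continuous with respect to $\mu_0$ with bounded Radon–Nikodym derivatives, such that 1. $K$ is an optimal transport kernel for $c$ on the measures absolutely continuous with respect to $\mu_0$: for every probability measure $\eta\ll\mu_0$ with $C(\eta,\eta K)<\infty$, the measure $\eta\odot K$ is an optimal coupling of $\eta$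 and $\eta K$; 2. $\mu_1\odot K=\gamma_1$ and $\mu_2\odot K=\gamma_2$. -/

import Mathlib

open MeasureTheory ProbabilityTheory
open scoped ENNReal NNReal

noncomputable section

namespace OTKernel

variable {X Y : Type*} [MeasurableSpace X] [MeasurableSpace Y]

/-- The functional `C(γ) = ∫ c dγ`; the cost functions in use are non-negative, so that the
integral makes sense in `[0, ∞]`. -/
def cost (c : X × Y → ℝ) (γ : Measure (X × Y)) : ℝ≥0∞ :=
  ∫⁻ z, ENNReal.ofReal (c z) ∂γ

/-- `γ` is a coupling of `μ` and `ν`: its two marginals are `μ` and `ν`. -/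
def IsCoupling (μ : Measure X) (ν : Measure Y) (γ : Measure (X × Y)) : Prop :=
  γ.map Prod.fst = μ ∧ γ.map Prod.snd = ν

/-- The optimal transport cost `C(μ, ν)`: the infimum of `C(γ)` over all couplings. -/
def transportCost (c : X × Y → ℝ) (μ : Measure X) (ν : Measure Y) : ℝ≥0∞ :=
  ⨅ (γ : Measure (X × Y)) (_ : IsCoupling μ ν γ), cost c γ

/-- `γ` is an optimal coupling of `μ` and `ν`: a coupling that attains the infimum. -/
def IsOptimalCoupling (c : X × Y → ℝ) (μ : Measure X) (ν : Measure Y)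
    (γ : Measure (X × Y)) : Prop :=
  IsCoupling μ ν γ ∧ cost c γ = transportCost c μ ν

/-- Probability measures `μ` with `h ∈ L¹(μ)`: this is `𝒫_c(X)` for `h = c_X` and `𝒫_c(Y)` for
`h = c_Y`. -/
def FiniteMoment (h : X → ℝ) : Set (Measure X) :=
  {μ | IsProbabilityMeasure μ ∧ Integrable h μ}

/-- `𝒜𝒞𝒫ᵇ_c(μ)`: the measures in `𝒫_c(X)` that are absolutely continuous with respect to `μ`
with a bounded Radon-Nikodym derivative. -/
def BoundedDensity (cX : X → ℝ) (μ : Measure X) : Set (Measure X) :=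
  {η | η ∈ FiniteMoment cX ∧ η ≪ μ ∧ ∃ M : ℝ≥0, ∀ᵐ x ∂μ, η.rnDeriv μ x ≤ M}

/-- `c`-cyclical monotonicity of a set `Γ ⊆ X × Y`. -/
def IsCyclicallyMonotone {X Y : Type*} (c : X × Y → ℝ) (Γ : Set (X × Y)) : Prop :=
  ∀ (N : ℕ) (σ : Equiv.Perm (Fin N)) (z : Fin N → X × Y), (∀ i, z i ∈ Γ) →
    ∑ i, c (z i) ≤ ∑ i, c ((z i).1, (z (σ i)).2)

/-- `c`-CM compatibility: the union of the two supports is `c`-cyclically monotone. -/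
def CMCompatible [TopologicalSpace X] [TopologicalSpace Y] (c : X × Y → ℝ)
    (γ₁ γ₂ : Measure (X × Y)) : Prop :=
  IsCyclicallyMonotone c (γ₁.support ∪ γ₂.support)

/-- The `X`-support of `γ`: the support of its first marginal. -/
def xSupport [TopologicalSpace X] (γ : Measure (X × Y)) : Set X :=
  (γ.map Prod.fst).support

/-- `K` is an optimal transport kernel on a class `D` of measures: `K` is a Markov kernel and, for
every probability measure `η ∈ D` such that the transport problem from `η` to `ηK` has finite
cost, the product measure `η ⊙ K` (Mathlib's `η ⊗ₘ K`) is an optimal coupling of `η` and `ηK`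
(Mathlib's `η.bind K`). -/
def IsOptimalTransportKernelOn (c : X × Y → ℝ) (D : Set (Measure X)) (K : Kernel X Y) : Prop :=
  IsMarkovKernel K ∧
    ∀ η ∈ D, IsProbabilityMeasure η → transportCost c η (η.bind K) < ∞ →
      IsOptimalCoupling c η (η.bind K) (η ⊗ₘ K)

end OTKernel

end

/-! Disintegrate the average `γ₀ = (γ₁ + γ₂) / 2` as `μ₀ ⊗ₘ K`. Multiplying `γ₀` by a function of
`x` alone changes `μ₀` but not `K`, so it suffices that both `γᵢ` have such densities. They do: the
`X`-supports are disjoint, and where `γ₁` and `γ₂` overlap both are multiples of `π₂` by functions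
of `x` (`withDensity_shareDensity`).

For optimality, the closed cyclically monotone set `Γ = supp γ₁ ∪ supp γ₂` carries `γ₀`, hence also
`η ⊗ₘ K` for every `η ≪ μ₀`. A measure carried by such a set is optimal
(`IsCyclicallyMonotone.lintegral_le`): Rockafellar's construction gives `φ`, `ψ` with `φ + ψ = c` on
a `σ`-compact carrier in `Γ` and `φ + ψ ≤ c` on the product of its projections. As `η` is arbitrary,
`φ` and `ψ` need not be integrable; truncation replaces integrability
(`lintegral_le_of_potentials`). -/

namespace OTKernel

/-! ### Duality with truncated potentials -/

section Clip

/-- Truncation of a real number to the interval `[-n, n]`. -/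
noncomputable def clip (n : ℕ) (s : ℝ) : ℝ := max (-n) (min s n)

lemma measurable_clip (n : ℕ) : Measurable (clip n) := by
  unfold clip; fun_prop

lemma abs_clip_le (n : ℕ) (s : ℝ) : |clip n s| ≤ n := by
  have hn : (0 : ℝ) ≤ n := n.cast_nonneg
  unfold clip
  exact abs_le.2 ⟨le_max_left _ _, max_le (by linarith) (min_le_right _ _)⟩

/-- `clip n` is odd and monotone, so `-t ≤ s` gives `-clip n t ≤ clip n s`. -/
lemma clip_add_clip_nonneg (n : ℕ) {s t : ℝ} (h : 0 ≤ s + t) : 0 ≤ clip n s + clip n t := by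
  have hn : (0 : ℝ) ≤ n := n.cast_nonneg
  unfold clip
  grind

/-- Oddness and monotonicity settle `s + t ≤ 0`; otherwise `clip n` is 1-Lipschitz. -/
lemma clip_add_clip_le (n : ℕ) (s t : ℝ) : clip n s + clip n t ≤ max (s + t) 0 := by
  have hn : (0 : ℝ) ≤ n := n.cast_nonneg
  unfold clip
  grind

lemma tendsto_clip (s : ℝ) : Filter.Tendsto (fun n => clip n s) Filter.atTop (nhds s) := by
  refine tendsto_const_nhds.congr' ?_
  obtain ⟨N, hN⟩ := exists_nat_ge |s|
  filter_upwards [Filter.eventually_ge_atTop N] with n hn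
  have h : |s| ≤ n := hN.trans (by exact_mod_cast hn)
  rw [clip, min_eq_left (abs_le.1 h).2, max_eq_right (abs_le.1 h).1]

end Clip

/-- A coupling on which a pair of dual potentials is tight is optimal; the potentials need not be
integrable. -/
lemma lintegral_le_of_potentials {X Y : Type*} [MeasurableSpace X] [MeasurableSpace Y]
    {c : X × Y → ℝ} (hc_nonneg : ∀ z, 0 ≤ c z)
    {γ γ' : Measure (X × Y)} [IsFiniteMeasure γ] [IsFiniteMeasure γ']
    (hfst : γ'.map Prod.fst = γ.map Prod.fst) (hsnd : γ'.map Prod.snd = γ.map Prod.snd)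
    {φ : X → ℝ} {ψ : Y → ℝ} (hφ : Measurable φ) (hψ : Measurable ψ)
    (heq : ∀ᵐ z ∂γ, φ z.1 + ψ z.2 = c z) (hle : ∀ᵐ z ∂γ', φ z.1 + ψ z.2 ≤ c z) :
    ∫⁻ z, ENNReal.ofReal (c z) ∂γ ≤ ∫⁻ z, ENNReal.ofReal (c z) ∂γ' := by
  set ξ : ℕ → X × Y → ℝ := fun n z => clip n (φ z.1) + clip n (ψ z.2) with hξ
  have hmφ : ∀ n, Measurable fun x => clip n (φ x) := fun n => (measurable_clip n).comp hφ
  have hmψ : ∀ n, Measurable fun y => clip n (ψ y) := fun n => (measurable_clip n).comp hψ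
  have hm : ∀ n, Measurable (ξ n) := fun n =>
    ((hmφ n).comp measurable_fst).add ((hmψ n).comp measurable_snd)
  have hi₁ : ∀ (n : ℕ) (ρ : Measure (X × Y)) [IsFiniteMeasure ρ],
      Integrable (fun z => clip n (φ z.1)) ρ := fun n ρ _ =>
    Integrable.of_bound ((hmφ n).comp measurable_fst).aestronglyMeasurable n
      (ae_of_all _ fun z => abs_clip_le n _)
  have hi₂ : ∀ (n : ℕ) (ρ : Measure (X × Y)) [IsFiniteMeasure ρ],
      Integrable (fun z => clip n (ψ z.2)) ρ := fun n ρ _ =>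
    Integrable.of_bound ((hmψ n).comp measurable_snd).aestronglyMeasurable n
      (ae_of_all _ fun z => abs_clip_le n _)
  have hi : ∀ (n : ℕ) (ρ : Measure (X × Y)) [IsFiniteMeasure ρ], Integrable (ξ n) ρ :=
    fun n ρ _ => (hi₁ n ρ).add (hi₂ n ρ)
  -- Bounded and split into functions of `x` and of `y`, `ξ n` only sees the marginals.
  have hint : ∀ n, ∫ z, ξ n z ∂γ = ∫ z, ξ n z ∂γ' := by
    intro n
    simp only [hξ]
    rw [integral_add (hi₁ n γ) (hi₂ n γ), integral_add (hi₁ n γ') (hi₂ n γ'),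
      ← integral_map (f := fun x => clip n (φ x)) measurable_fst.aemeasurable
        (hmφ n).aestronglyMeasurable,
      ← integral_map (f := fun x => clip n (φ x)) measurable_fst.aemeasurable
        (hmφ n).aestronglyMeasurable,
      ← integral_map (f := fun y => clip n (ψ y)) measurable_snd.aemeasurable
        (hmψ n).aestronglyMeasurable,
      ← integral_map (f := fun y => clip n (ψ y)) measurable_snd.aemeasurable
        (hmψ n).aestronglyMeasurable, hfst, hsnd]
  have hbound : ∀ n, ∫⁻ z, ENNReal.ofReal (ξ n z) ∂γ ≤ ∫⁻ z, ENNReal.ofReal (c z) ∂γ' := by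
    intro n
    rw [← ofReal_integral_eq_lintegral_ofReal (hi n γ)
      (by filter_upwards [heq] with z hz
          exact clip_add_clip_nonneg n (hz ▸ hc_nonneg z))]
    rw [hint n, integral_eq_lintegral_pos_part_sub_lintegral_neg_part (hi n γ')]
    refine (ENNReal.ofReal_le_ofReal (sub_le_self _ ENNReal.toReal_nonneg)).trans ?_
    refine ENNReal.ofReal_toReal_le.trans (lintegral_mono_ae ?_)
    filter_upwards [hle] with z hz
    exact ENNReal.ofReal_le_ofReal
      ((clip_add_clip_le n _ _).trans (max_le hz (hc_nonneg z)))
  -- Fatou's lemma, as `ξ n` tends to `c` almost everywhere for `γ`.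
  calc ∫⁻ z, ENNReal.ofReal (c z) ∂γ
      = ∫⁻ z, Filter.liminf (fun n => ENNReal.ofReal (ξ n z)) Filter.atTop ∂γ := by
        refine lintegral_congr_ae ?_
        filter_upwards [heq] with z hz
        refine (Filter.Tendsto.liminf_eq ?_).symm
        rw [← hz]
        exact (ENNReal.continuous_ofReal.tendsto _).comp
          ((tendsto_clip _).add (tendsto_clip _))
    _ ≤ Filter.liminf (fun n => ∫⁻ z, ENNReal.ofReal (ξ n z) ∂γ) Filter.atTop :=
        lintegral_liminf_le fun n => (hm n).ennreal_ofReal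
    _ ≤ ∫⁻ z, ENNReal.ofReal (c z) ∂γ' :=
        Filter.liminf_le_of_le (by isBoundedDefault) fun b hb => by
          obtain ⟨n, hn⟩ := hb.exists
          exact hn.trans (hbound n)

/-! ### Rockafellar's potential and its measurability -/

/-- The functions `x ↦ ∑ (c (xᵢ₊₁, yᵢ) - c (xᵢ, yᵢ))` along the chains in `Γ` that start at `z₀`
and end at `x`; their infimum is Rockafellar's potential. -/
inductive IsChainFunction {X Y : Type*} (c : X × Y → ℝ) (Γ : Set (X × Y)) (z₀ : X × Y) :
    (X → ℝ) → Prop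
  | base : IsChainFunction c Γ z₀ (fun x => c (x, z₀.2) - c z₀)
  | step {u : X → ℝ} (hu : IsChainFunction c Γ z₀ u) {z : X × Y} (hz : z ∈ Γ) :
      IsChainFunction c Γ z₀ (fun x => u z.1 + (c (x, z.2) - c z))

lemma IsChainFunction.exists_fin {X Y : Type*} {c : X × Y → ℝ} {Γ : Set (X × Y)} {z₀ : X × Y}
    (hz₀ : z₀ ∈ Γ) {u : X → ℝ} (hu : IsChainFunction c Γ z₀ u) :
    ∃ (N : ℕ) (z : Fin (N + 1) → X × Y), (∀ i, z i ∈ Γ) ∧ z 0 = z₀ ∧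
      ∀ x, u x = ∑ i : Fin N, c ((z i.succ).1, (z i.castSucc).2) + c (x, (z (Fin.last N)).2)
        - ∑ i, c (z i) := by
  induction hu with
  | base => exact ⟨0, fun _ => z₀, fun _ => hz₀, rfl, fun x => by simp⟩
  | @step u _ w hw ih =>
    obtain ⟨N, z, hz, h0, hu⟩ := ih
    refine ⟨N + 1, Fin.snoc z w, fun i => ?_, ?_, fun x => ?_⟩
    · induction i using Fin.lastCases with
      | last => simpa using hw
      | cast i => simpa using hz i
    · rw [← Fin.castSucc_zero, Fin.snoc_castSucc, h0]
    · have h₁ : ∑ i, c ((Fin.snoc z w : Fin (N + 2) → X × Y) i) = ∑ i, c (z i) + c w := by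
        rw [Fin.sum_univ_castSucc]
        simp only [Fin.snoc_castSucc, Fin.snoc_last]
      have h₂ : ∑ i : Fin (N + 1), c (((Fin.snoc z w : Fin (N + 2) → X × Y) i.succ).1, (z i).2) =
          ∑ i : Fin N, c ((z i.succ).1, (z i.castSucc).2) + c (w.1, (z (Fin.last N)).2) := by
        rw [Fin.sum_univ_castSucc]
        simp only [Fin.succ_castSucc, Fin.snoc_castSucc, Fin.snoc_last, Fin.succ_last]
      simp only [Fin.snoc_castSucc, Fin.snoc_last]
      rw [hu, h₁, h₂]
      ring

lemma IsCyclicallyMonotone.chain_nonneg {X Y : Type*} {c : X × Y → ℝ} {Γ : Set (X × Y)}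
    (hΓ : IsCyclicallyMonotone c Γ) {z₀ : X × Y} (hz₀ : z₀ ∈ Γ) {u : X → ℝ}
    (hu : IsChainFunction c Γ z₀ u) : 0 ≤ u z₀.1 := by
  obtain ⟨N, z, hz, h0, hu⟩ := hu.exists_fin hz₀
  -- The inverse rotation pairs `xᵢ` with `yᵢ₋₁`; reindexed, these are the links `c (xᵢ₊₁, yᵢ)`, and
  -- the last one closes the chain at `x₀`.
  have h := hΓ (N + 1) (finRotate (N + 1)).symm z hz
  rw [← Equiv.sum_comp (finRotate (N + 1)) (fun i => c ((z i).1, (z ((finRotate (N + 1)).symm i)).2)),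
    Fin.sum_univ_castSucc (n := N) (fun i => c ((z (finRotate (N + 1) i)).1, _))] at h
  simp only [Equiv.symm_apply_apply, finRotate_last, h0] at h
  rw [hu]
  have h2 : ∀ i : Fin N, finRotate (N + 1) i.castSucc = i.succ := fun i => by
    rw [finRotate_apply, Fin.coeSucc_eq_succ]
  have h3 : (finRotate (N + 1)).symm 0 = Fin.last N := by
    rw [Equiv.symm_apply_eq, finRotate_last]
  simp only [h2, h3] at h
  linarith

lemma IsChainFunction.continuous {X Y : Type*} [TopologicalSpace X] [TopologicalSpace Y]
    {c : X × Y → ℝ} (hc : Continuous c) {Γ : Set (X × Y)} {z₀ : X × Y}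
    {u : X → ℝ} (hu : IsChainFunction c Γ z₀ u) : Continuous u := by
  induction hu with
  | base => fun_prop
  | step _ _ _ => fun_prop

/-- The infimum of the chain functions. -/
noncomputable def rockafellar {X Y : Type*} (c : X × Y → ℝ) (Γ : Set (X × Y)) (z₀ : X × Y)
    (x : X) : ℝ :=
  ⨅ u : {u // IsChainFunction c Γ z₀ u}, u.1 x

section Rockafellar

variable {X Y : Type*} {c : X × Y → ℝ} {Γ : Set (X × Y)} {z₀ : X × Y}

/-- A chain ending at `z.1` can be prolonged through `z` back to `z₀.1`, where its value is
non-negative. Away from the first projection of `Γ` the real infimum may be a default value. -/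
lemma bddBelow_chain (hΓ : IsCyclicallyMonotone c Γ) (hz₀ : z₀ ∈ Γ) {z : X × Y} (hz : z ∈ Γ) :
    BddBelow (Set.range fun u : {u // IsChainFunction c Γ z₀ u} => u.1 z.1) := by
  refine ⟨c z - c (z₀.1, z.2), ?_⟩
  rintro _ ⟨u, rfl⟩
  have := hΓ.chain_nonneg hz₀ (u.2.step hz)
  dsimp only at this ⊢
  linarith

lemma le_rockafellar_iff (hΓ : IsCyclicallyMonotone c Γ) (hz₀ : z₀ ∈ Γ) {z : X × Y} (hz : z ∈ Γ)
    {t : ℝ} : t ≤ rockafellar c Γ z₀ z.1 ↔ ∀ u, IsChainFunction c Γ z₀ u → t ≤ u z.1 := by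
  have : Nonempty {u // IsChainFunction c Γ z₀ u} := ⟨⟨_, .base⟩⟩
  rw [rockafellar, le_ciInf_iff (bddBelow_chain hΓ hz₀ hz), Subtype.forall]

/-- Every chain ending at `z.1` extends through `z` to one ending at `w.1`. -/
lemma rockafellar_le (hΓ : IsCyclicallyMonotone c Γ) (hz₀ : z₀ ∈ Γ) {z w : X × Y} (hz : z ∈ Γ)
    (hw : w ∈ Γ) :
    rockafellar c Γ z₀ w.1 ≤ rockafellar c Γ z₀ z.1 + (c (w.1, z.2) - c z) := by
  rw [← sub_le_iff_le_add, le_rockafellar_iff hΓ hz₀ hz]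
  intro u hu
  rw [sub_le_iff_le_add]
  exact (le_rockafellar_iff hΓ hz₀ hw).1 le_rfl _ (hu.step hz)

end Rockafellar

/-- A continuous image of a `σ`-compact set is measurable. -/
lemma measurableSet_image_iUnion_of_isCompact {Z W : Type*} [TopologicalSpace Z]
    [TopologicalSpace W] [T2Space W] [MeasurableSpace W] [OpensMeasurableSpace W] {f : Z → W}
    (hf : Continuous f) {κ : ℕ → Set Z} (hκ : ∀ n, IsCompact (κ n)) :
    MeasurableSet (f '' ⋃ n, κ n) := by
  rw [Set.image_iUnion]
  exact .iUnion fun n => ((hκ n).image hf).measurableSet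

section Potentials

variable {X Y : Type*} [TopologicalSpace X] [TopologicalSpace Y]
  {c : X × Y → ℝ} {Γ : Set (X × Y)} {z₀ : X × Y} {κ : ℕ → Set (X × Y)}

open Classical in
/-- On the first projection of a `σ`-compact subset of `Γ` the Rockafellar potential is
measurable. -/
lemma exists_measurable_eq_rockafellar [T2Space X] [MeasurableSpace X] [BorelSpace X]
    (hc : Continuous c) (hΓ : IsCyclicallyMonotone c Γ) (hz₀ : z₀ ∈ Γ)
    (hκ : ∀ n, IsCompact (κ n)) (hκΓ : ⋃ n, κ n ⊆ Γ) :
    ∃ φ : X → ℝ, Measurable φ ∧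
      ∀ z ∈ ⋃ n, κ n, φ z.1 = rockafellar c Γ z₀ z.1 := by
  set A : Set X := Prod.fst '' ⋃ n, κ n
  have hA : MeasurableSet A := measurableSet_image_iUnion_of_isCompact continuous_fst hκ
  refine ⟨fun x => if x ∈ A then rockafellar c Γ z₀ x else 0, measurable_of_Ici fun t => ?_,
    fun z hz => if_pos ⟨z, hz, rfl⟩⟩
  have h : (fun x => if x ∈ A then rockafellar c Γ z₀ x else 0) ⁻¹' Set.Ici t =
      (A ∩ {x | ∀ u, IsChainFunction c Γ z₀ u → t ≤ u x}) ∪ (Aᶜ ∩ {_x | t ≤ 0}) := by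
    ext x
    by_cases hx : x ∈ A
    · obtain ⟨z, hz, rfl⟩ := id hx
      simp [hx, le_rockafellar_iff hΓ hz₀ (hκΓ hz)]
    · simp [hx]
  rw [h]
  refine (hA.inter ?_).union (hA.compl.inter (MeasurableSet.const _))
  simp only [Set.ofPred_forall]
  -- The intersection may be uncountable; it is closed because chain functions are continuous.
  exact (isClosed_iInter fun u => isClosed_iInter fun hu =>
    isClosed_le continuous_const (hu.continuous hc)).measurableSet

open Classical in
/-- On the second projection of a `σ`-compact subset of `Γ` the conjugate of the Rockafellar
potential is measurable. -/
lemma exists_measurable_eq_sub_rockafellar [T2Space Y] [MeasurableSpace Y] [BorelSpace Y]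
    (hc : Continuous c) (hΓ : IsCyclicallyMonotone c Γ) (hz₀ : z₀ ∈ Γ)
    (hκ : ∀ n, IsCompact (κ n)) (hκΓ : ⋃ n, κ n ⊆ Γ) :
    ∃ ψ : Y → ℝ, Measurable ψ ∧
      ∀ z ∈ ⋃ n, κ n, ψ z.2 = c z - rockafellar c Γ z₀ z.1 := by
  set S : Set (X × Y) := ⋃ n, κ n
  set B : Set Y := Prod.snd '' S
  have hB : MeasurableSet B := measurableSet_image_iUnion_of_isCompact continuous_snd hκ
  set ψ : Y → ℝ := fun y =>
    if h : ∃ x, (x, y) ∈ S then c (h.choose, y) - rockafellar c Γ z₀ h.choose else 0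
  have hψ : ∀ z ∈ S, ψ z.2 = c z - rockafellar c Γ z₀ z.1 := by
    intro z hz
    have h : ∃ x, (x, z.2) ∈ S := ⟨z.1, hz⟩
    -- The two inequalities show that the value does not depend on the chosen `x` over `z.2`.
    have h₁ := rockafellar_le hΓ hz₀ (hκΓ hz) (hκΓ h.choose_spec)
    have h₂ := rockafellar_le hΓ hz₀ (hκΓ h.choose_spec) (hκΓ hz)
    simp only [ψ, dif_pos h]
    simp only [Prod.mk.eta] at h₁ h₂
    linarith
  refine ⟨ψ, measurable_of_Iic fun t => ?_, hψ⟩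
  -- Up to the default value off `B`, a sublevel set of `ψ` is the projection of a `σ`-compact set.
  have h : ψ ⁻¹' Set.Iic t =
      (Prod.snd '' ⋃ n, κ n ∩ {z | ∀ u, IsChainFunction c Γ z₀ u → c z - t ≤ u z.1}) ∪
        (Bᶜ ∩ {_y | 0 ≤ t}) := by
    rw [← Set.iUnion_inter]
    ext y
    by_cases hy : y ∈ B
    · simp only [Set.mem_preimage, Set.mem_Iic, Set.mem_union, Set.mem_inter_iff,
        Set.mem_compl_iff, hy, not_true_eq_false, false_and, or_false, Set.mem_image,
        Set.mem_ofPred_eq]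
      constructor
      · intro hyt
        obtain ⟨z, hz, rfl⟩ := hy
        refine ⟨z, ⟨hz, ?_⟩, rfl⟩
        rw [← le_rockafellar_iff hΓ hz₀ (hκΓ hz)]
        linarith [hψ z hz]
      · rintro ⟨z, ⟨hz, hzt⟩, rfl⟩
        rw [← le_rockafellar_iff hΓ hz₀ (hκΓ hz)] at hzt
        linarith [hψ z hz]
    · have h₀ : ψ y = 0 := dif_neg fun ⟨x, hx⟩ => hy ⟨(x, y), hx, rfl⟩
      have h₁ : y ∉ Prod.snd '' (S ∩ {z | ∀ u, IsChainFunction c Γ z₀ u → c z - t ≤ u z.1}) :=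
        fun h => hy (Set.image_mono Set.inter_subset_left h)
      simp only [Set.mem_preimage, Set.mem_Iic, h₀, Set.mem_union, Set.mem_inter_iff,
        Set.mem_compl_iff, hy, not_false_eq_true, true_and, Set.mem_ofPred_eq]
      exact ⟨Or.inr, fun h => h.resolve_left h₁⟩
  rw [h]
  refine (measurableSet_image_iUnion_of_isCompact continuous_snd fun n => (hκ n).inter_right ?_).union
    (hB.compl.inter (MeasurableSet.const _))
  simp only [Set.ofPred_forall]
  exact isClosed_iInter fun u => isClosed_iInter fun hu =>
    isClosed_le (hc.sub continuous_const) ((hu.continuous hc).comp continuous_fst)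

end Potentials

/-! ### Optimality of measures carried by a cyclically monotone set -/

/-- A finite measure on a Polish space that is carried by a closed set is carried by a
`σ`-compact subset of it. -/
lemma exists_compact_seq_measure_compl_iUnion_eq_zero {Z : Type*} [TopologicalSpace Z]
    [PolishSpace Z] [MeasurableSpace Z] [BorelSpace Z] {γ : Measure Z} [IsFiniteMeasure γ]
    {Γ : Set Z} (hΓ : IsClosed Γ) (hγ : γ Γᶜ = 0) :
    ∃ κ : ℕ → Set Z, (∀ n, IsCompact (κ n)) ∧ ⋃ n, κ n ⊆ Γ ∧ γ (⋃ n, κ n)ᶜ = 0 := by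
  have h := isTightMeasureSet_iff_exists_isCompact_measure_compl_le.1
    (isTightMeasureSet_singleton (μ := γ))
  choose κ hκ hκγ using fun n : ℕ =>
    h ((n : ℝ≥0∞)⁻¹) (ENNReal.inv_pos.2 (ENNReal.natCast_ne_top n))
  refine ⟨fun n => κ n ∩ Γ, fun n => (hκ n).inter_right hΓ,
    Set.iUnion_subset fun n => Set.inter_subset_right, ?_⟩
  refine le_antisymm (ge_of_tendsto' ENNReal.tendsto_inv_nat_nhds_zero fun n => ?_) zero_le
  calc γ (⋃ n, κ n ∩ Γ)ᶜ ≤ γ ((κ n)ᶜ ∪ Γᶜ) := by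
        rw [← Set.compl_inter]
        exact measure_mono (Set.compl_subset_compl.2 (Set.subset_iUnion (fun n => κ n ∩ Γ) n))
    _ ≤ γ (κ n)ᶜ + γ Γᶜ := measure_union_le _ _
    _ ≤ (n : ℝ≥0∞)⁻¹ := by
        rw [hγ, add_zero]
        exact hκγ n γ rfl

/-- For a continuous real-valued non-negative cost, a measure carried by a closed `c`-cyclically
monotone set is cheaper than every measure with the same marginals. -/
lemma IsCyclicallyMonotone.lintegral_le {X Y : Type*}
    [TopologicalSpace X] [PolishSpace X] [MeasurableSpace X] [BorelSpace X]
    [TopologicalSpace Y] [PolishSpace Y] [MeasurableSpace Y] [BorelSpace Y]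
    {c : X × Y → ℝ} (hc : Continuous c) (hc_nonneg : ∀ z, 0 ≤ c z)
    {Γ : Set (X × Y)} (hΓ : IsCyclicallyMonotone c Γ) (hΓ_closed : IsClosed Γ)
    {γ γ' : Measure (X × Y)} [IsFiniteMeasure γ] [IsFiniteMeasure γ'] (hγ : γ Γᶜ = 0)
    (hfst : γ'.map Prod.fst = γ.map Prod.fst) (hsnd : γ'.map Prod.snd = γ.map Prod.snd) :
    ∫⁻ z, ENNReal.ofReal (c z) ∂γ ≤ ∫⁻ z, ENNReal.ofReal (c z) ∂γ' := by
  obtain rfl | ⟨z₀, hz₀⟩ := Γ.eq_empty_or_nonempty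
  · rw [Set.compl_empty, Measure.measure_univ_eq_zero] at hγ
    simp [hγ]
  obtain ⟨κ, hκ, hκΓ, hκγ⟩ := exists_compact_seq_measure_compl_iUnion_eq_zero hΓ_closed hγ
  obtain ⟨φ, hφm, hφ⟩ := exists_measurable_eq_rockafellar hc hΓ hz₀ hκ hκΓ
  obtain ⟨ψ, hψm, hψ⟩ := exists_measurable_eq_sub_rockafellar hc hΓ hz₀ hκ hκΓ
  have hmem : ∀ᵐ z ∂γ, z ∈ ⋃ n, κ n := hκγ
  refine lintegral_le_of_potentials hc_nonneg hfst hsnd hφm hψm ?_ ?_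
  · filter_upwards [hmem] with z hz
    rw [hφ z hz, hψ z hz]
    ring
  · have hA : ∀ᵐ x ∂γ'.map Prod.fst, x ∈ Prod.fst '' ⋃ n, κ n := by
      rw [hfst]
      refine (ae_map_iff measurable_fst.aemeasurable
        (measurableSet_image_iUnion_of_isCompact continuous_fst hκ)).2 ?_
      filter_upwards [hmem] with z hz using ⟨z, hz, rfl⟩
    have hB : ∀ᵐ y ∂γ'.map Prod.snd, y ∈ Prod.snd '' ⋃ n, κ n := by
      rw [hsnd]
      refine (ae_map_iff measurable_snd.aemeasurable
        (measurableSet_image_iUnion_of_isCompact continuous_snd hκ)).2 ?_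
      filter_upwards [hmem] with z hz using ⟨z, hz, rfl⟩
    -- A point `(x, y)` need not lie in `Γ`, but equality of marginals puts some `v ∈ Γ` over `x`
    -- and some `w ∈ Γ` over `y`.
    filter_upwards [ae_of_ae_map measurable_fst.aemeasurable hA,
      ae_of_ae_map measurable_snd.aemeasurable hB]
    rintro ⟨x, y⟩ ⟨v, hv, rfl⟩ ⟨w, hw, rfl⟩
    have := rockafellar_le hΓ hz₀ (hκΓ hw) (hκΓ hv)
    dsimp only
    rw [hφ v hv, hψ w hw]
    linarith

/-! ### Densities depending on `x` only, and the common kernel -/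

lemma withDensity_compProd {X Y : Type*} [MeasurableSpace X] [MeasurableSpace Y]
    (μ : Measure X) [SFinite μ] (K : Kernel X Y) [IsSFiniteKernel K] {h : X → ℝ≥0∞}
    (hh : Measurable h) [SFinite (μ.withDensity h)] :
    (μ.withDensity h) ⊗ₘ K = (μ ⊗ₘ K).withDensity fun z => h z.1 := by
  ext s hs
  have hm : Measurable fun z : X × Y => h z.1 := hh.comp measurable_fst
  rw [withDensity_apply _ hs, Measure.compProd_apply hs, ← lintegral_indicator hs,
    Measure.lintegral_compProd (hm.indicator hs),
    lintegral_withDensity_eq_lintegral_mul _ hh (Kernel.measurable_kernel_prodMk_left hs)]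
  refine lintegral_congr fun x => ?_
  have : (fun y => s.indicator (fun z : X × Y => h z.1) (x, y)) =
      (Prod.mk x ⁻¹' s).indicator fun _ => h x := rfl
  rw [this, lintegral_indicator_const (measurable_prodMk_left hs), Pi.mul_apply]

lemma ae_fst_mem_xSupport {X Y : Type*} [MeasurableSpace X] [MeasurableSpace Y]
    [TopologicalSpace X] [HereditarilyLindelofSpace X] [TopologicalSpace Y]
    (π : Measure (X × Y)) : ∀ᵐ z ∂π, z.1 ∈ xSupport π :=
  ae_of_ae_map measurable_fst.aemeasurable Measure.support_mem_ae

open Classical in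
/-- The density in `x` of `a π₁ + f π₂` with respect to `a π₁ + (f + g) π₂ + b π₃`, when the
measures `πᵢ` have disjoint `X`-supports and that of `π₁` is `S`. -/
noncomputable def shareDensity {X : Type*} (S : Set X) (f g : X → ℝ≥0) (x : X) : ℝ≥0 :=
  (if x ∈ S then 1 else 0) + f x / (f x + g x)

section ShareDensity

variable {X : Type*} {S : Set X} {f g : X → ℝ≥0}

lemma measurable_shareDensity [MeasurableSpace X] (hS : MeasurableSet S) (hf : Measurable f)
    (hg : Measurable g) : Measurable (shareDensity S f g) := by
  classical
  exact (Measurable.ite hS measurable_const measurable_const).add (hf.div (hf.add hg))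

lemma shareDensity_le (x : X) : shareDensity S f g x ≤ 2 := by
  have h₁ : f x / (f x + g x) ≤ 1 := div_le_one_of_le₀ le_self_add zero_le
  rw [← one_add_one_eq_two, shareDensity]
  refine add_le_add ?_ h₁
  split_ifs <;> simp

/-- Where `f + g = 0` the quotient takes its default value, but `f` vanishes there too. -/
lemma add_mul_shareDensity {x : X} (hx : x ∉ S) :
    f x * shareDensity S f g x + g x * shareDensity S f g x = f x := by
  rw [shareDensity, if_neg hx, zero_add, ← add_mul]
  by_cases h : f x + g x = 0
  · rw [h, zero_mul, (add_eq_zero.1 h).1]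
  · rw [mul_div_cancel₀ _ h]

end ShareDensity

/-- On the three `X`-supports the density is `1`, `f / (f + g)` and `0`; the outer values use that
`f` vanishes off the support of `π₂`. -/
lemma withDensity_shareDensity {X Y : Type*} [MeasurableSpace X] [MeasurableSpace Y]
    [TopologicalSpace X] [HereditarilyLindelofSpace X] [OpensMeasurableSpace X]
    [TopologicalSpace Y] {π₁ π₂ π₃ : Measure (X × Y)}
    (h₁₂ : Disjoint (xSupport π₁) (xSupport π₂)) (h₁₃ : Disjoint (xSupport π₁) (xSupport π₃))
    (h₂₃ : Disjoint (xSupport π₂) (xSupport π₃)) (a b : ℝ≥0) {f g : X → ℝ≥0}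
    (hf : Measurable f) (hg : Measurable g) (hf_zero : ∀ x, x ∉ xSupport π₂ → f x = 0) :
    ((a • π₁ + π₂.withDensity (fun z => (f z.1 : ℝ≥0∞))) +
      (π₂.withDensity (fun z => (g z.1 : ℝ≥0∞)) + b • π₃)).withDensity
        (fun z => (shareDensity (xSupport π₁) f g z.1 : ℝ≥0∞)) =
      a • π₁ + π₂.withDensity (fun z => (f z.1 : ℝ≥0∞)) := by
  have hh : Measurable fun z : X × Y => (shareDensity (xSupport π₁) f g z.1 : ℝ≥0∞) :=
    ((measurable_shareDensity Measure.isClosed_support.measurableSet hf hg).comp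
      measurable_fst).coe_nnreal_ennreal
  have hf' : Measurable fun z : X × Y => (f z.1 : ℝ≥0∞) :=
    (hf.comp measurable_fst).coe_nnreal_ennreal
  have hg' : Measurable fun z : X × Y => (g z.1 : ℝ≥0∞) :=
    (hg.comp measurable_fst).coe_nnreal_ennreal
  have e₁ : π₁.withDensity (fun z => (shareDensity (xSupport π₁) f g z.1 : ℝ≥0∞)) = π₁ := by
    rw [withDensity_congr_ae (g := 1), withDensity_one]
    filter_upwards [ae_fst_mem_xSupport π₁] with z hz
    simp [shareDensity, hz, hf_zero _ (h₁₂.notMem_of_mem_left hz)]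
  have e₃ : π₃.withDensity (fun z => (shareDensity (xSupport π₁) f g z.1 : ℝ≥0∞)) = 0 := by
    rw [withDensity_congr_ae (g := 0), withDensity_zero]
    filter_upwards [ae_fst_mem_xSupport π₃] with z hz
    simp [shareDensity, h₁₃.notMem_of_mem_right hz, hf_zero _ (h₂₃.notMem_of_mem_right hz)]
  have e₂ : (π₂.withDensity (fun z => (f z.1 : ℝ≥0∞))).withDensity
        (fun z => (shareDensity (xSupport π₁) f g z.1 : ℝ≥0∞)) +
      (π₂.withDensity (fun z => (g z.1 : ℝ≥0∞))).withDensity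
        (fun z => (shareDensity (xSupport π₁) f g z.1 : ℝ≥0∞)) =
      π₂.withDensity (fun z => (f z.1 : ℝ≥0∞)) := by
    rw [← withDensity_mul _ hf' hh, ← withDensity_mul _ hg' hh,
      ← withDensity_add_left (hf'.mul hh)]
    refine withDensity_congr_ae ?_
    filter_upwards [ae_fst_mem_xSupport π₂] with z hz
    simp only [Pi.add_apply, Pi.mul_apply]
    exact_mod_cast add_mul_shareDensity (f := f) (g := g) (h₁₂.notMem_of_mem_right hz)
  have e : ∀ (r : ℝ≥0) (π : Measure (X × Y)) (h : X × Y → ℝ≥0∞),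
      (r • π).withDensity h = r • π.withDensity h := fun r π h =>
    withDensity_smul_measure (r : ℝ≥0∞) h
  rw [withDensity_add_measure, withDensity_add_measure, withDensity_add_measure, e, e, e₁, e₃,
    smul_zero, add_zero, add_assoc, e₂]

/-- A Markov kernel `K` such that `μ₀ ⊗ₘ K` is carried by a closed `c`-cyclically monotone set is an
optimal transport kernel on the measures that are absolutely continuous with respect to `μ₀`. -/
lemma IsCyclicallyMonotone.isOptimalTransportKernelOn {X Y : Type*}
    [TopologicalSpace X] [PolishSpace X] [MeasurableSpace X] [BorelSpace X]
    [TopologicalSpace Y] [PolishSpace Y] [MeasurableSpace Y] [BorelSpace Y]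
    {c : X × Y → ℝ} (hc : Continuous c) (hc_nonneg : ∀ z, 0 ≤ c z)
    {Γ : Set (X × Y)} (hΓ : IsCyclicallyMonotone c Γ) (hΓ_closed : IsClosed Γ)
    {μ₀ : Measure X} [SFinite μ₀] {K : Kernel X Y} [hK : IsMarkovKernel K]
    (h₀ : (μ₀ ⊗ₘ K) Γᶜ = 0) : IsOptimalTransportKernelOn c {η | η ≪ μ₀} K := by
  refine ⟨hK, fun η hη _ _ => ?_⟩
  have hcoup : IsCoupling η (η.bind K) (η ⊗ₘ K) :=
    ⟨Measure.fst_compProd η K, Measure.snd_compProd η K⟩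
  refine ⟨hcoup, le_antisymm (le_iInf₂ fun γ' hγ' => ?_) (iInf₂_le _ hcoup)⟩
  -- A competitor is finite because its first marginal is `η`.
  have : IsFiniteMeasure γ' := ⟨by
    rw [← Set.preimage_univ (f := Prod.fst), ← Measure.map_apply measurable_fst .univ, hγ'.1]
    exact measure_lt_top _ _⟩
  exact hΓ.lintegral_le hc hc_nonneg hΓ_closed (Measure.AbsolutelyContinuous.compProd_left hη K h₀)
    (hγ'.1.trans hcoup.1.symm) (hγ'.2.trans hcoup.2.symm)

/-- A measure of the form `h(x) γ₀(dx, dy)` with `h` bounded is `μ ⊗ₘ K` for the conditional kernel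
`K` of `γ₀`, where `μ` has a bounded density with respect to the first marginal of `γ₀`. -/
lemma exists_boundedDensity_compProd_eq {X Y : Type*} [MeasurableSpace X] [MeasurableSpace Y]
    [StandardBorelSpace Y] [Nonempty Y] {cX : X → ℝ} {γ γ₀ : Measure (X × Y)} [IsFiniteMeasure γ₀]
    {h : X → ℝ≥0} (hh : Measurable h) {M : ℝ≥0} (hM : ∀ x, h x ≤ M)
    (hγ : γ₀.withDensity (fun z => (h z.1 : ℝ≥0∞)) = γ)
    (hγX : γ.map Prod.fst ∈ FiniteMoment cX) :
    ∃ μ ∈ BoundedDensity cX γ₀.fst, μ ⊗ₘ γ₀.condKernel = γ := by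
  have hm : Measurable fun x => (h x : ℝ≥0∞) := hh.coe_nnreal_ennreal
  have hprod : (γ₀.fst.withDensity fun x => (h x : ℝ≥0∞)) ⊗ₘ γ₀.condKernel = γ := by
    rw [withDensity_compProd _ _ hm, γ₀.disintegrate, hγ]
  refine ⟨γ₀.fst.withDensity fun x => (h x : ℝ≥0∞),
    ⟨?_, withDensity_absolutelyContinuous _ _, M, ?_⟩,
    hprod⟩
  · rwa [← hprod, ← Measure.fst, Measure.fst_compProd] at hγX
  · filter_upwards [Measure.rnDeriv_withDensity γ₀.fst hm] with x hx
    rw [hx]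
    exact_mod_cast hM x

end OTKernel

theorem mainTheorem10 {X Y : Type*}
    [TopologicalSpace X] [PolishSpace X] [MeasurableSpace X] [BorelSpace X]
    [TopologicalSpace Y] [PolishSpace Y] [MeasurableSpace Y] [BorelSpace Y]
    (c : X × Y → ℝ) (hc : Continuous c) (hc_nonneg : ∀ z, 0 ≤ c z)
    (cX : X → ℝ) (cY : Y → ℝ) (hc_le : ∀ x y, c (x, y) ≤ cX x + cY y)
    (γ₁ γ₂ π₁ π₂ π₃ : Measure (X × Y))
    [IsProbabilityMeasure π₁] [IsProbabilityMeasure π₂] [IsProbabilityMeasure π₃]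
    (hX₁ : γ₁.map Prod.fst ∈ OTKernel.FiniteMoment cX)
    (hY₁ : γ₁.map Prod.snd ∈ OTKernel.FiniteMoment cY)
    (hX₂ : γ₂.map Prod.fst ∈ OTKernel.FiniteMoment cX)
    (hY₂ : γ₂.map Prod.snd ∈ OTKernel.FiniteMoment cY)
    (hopt₁ : OTKernel.IsOptimalCoupling c (γ₁.map Prod.fst) (γ₁.map Prod.snd) γ₁)
    (hopt₂ : OTKernel.IsOptimalCoupling c (γ₂.map Prod.fst) (γ₂.map Prod.snd) γ₂)
    (hcompat : OTKernel.CMCompatible c γ₁ γ₂)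
    (hdisj₁₂ : Disjoint (OTKernel.xSupport π₁) (OTKernel.xSupport π₂))
    (hdisj₁₃ : Disjoint (OTKernel.xSupport π₁) (OTKernel.xSupport π₃))
    (hdisj₂₃ : Disjoint (OTKernel.xSupport π₂) (OTKernel.xSupport π₃))
    (a b : ℝ≥0) (f g : X → ℝ≥0) (hf : Measurable f) (hg : Measurable g)
    (hf_zero : ∀ x, x ∉ OTKernel.xSupport π₂ → f x = 0)
    (hg_zero : ∀ x, x ∉ OTKernel.xSupport π₂ → g x = 0)
    (hγ₁ : γ₁ = a • π₁ + π₂.withDensity (fun z => (f z.1 : ℝ≥0∞)))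
    (hγ₂ : γ₂ = π₂.withDensity (fun z => (g z.1 : ℝ≥0∞)) + b • π₃) :
    ∃ (K : Kernel X Y) (μ₀ μ₁ μ₂ : Measure X),
      μ₀ ∈ OTKernel.FiniteMoment cX ∧
      OTKernel.IsOptimalTransportKernelOn c {η | η ≪ μ₀} K ∧
      μ₁ ∈ OTKernel.BoundedDensity cX μ₀ ∧
      μ₂ ∈ OTKernel.BoundedDensity cX μ₀ ∧
      μ₁ ⊗ₘ K = γ₁ ∧
      μ₂ ⊗ₘ K = γ₂ := by

  have : Nonempty Y := by
    obtain ⟨z⟩ : Nonempty (X × Y) := nonempty_of_isProbabilityMeasure π₁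
    exact ⟨z.2⟩
  have hp : ∀ {γ : Measure (X × Y)}, γ.map Prod.fst ∈ OTKernel.FiniteMoment cX →
      IsProbabilityMeasure γ := fun {γ} h => by
    have := h.1
    exact Measure.isProbabilityMeasure_of_map Prod.fst
  have := hp hX₁
  have := hp hX₂
  -- The factor `2` offsets the `1/2` in `γ₀`.
  have hm : ∀ (π : Measure (X × Y)) {f g : X → ℝ≥0}, Measurable f → Measurable g →
      Measurable fun x => 2 * OTKernel.shareDensity (OTKernel.xSupport π) f g x :=
    fun π _ _ hf hg => (OTKernel.measurable_shareDensity
      Measure.isClosed_support.measurableSet hf hg).const_mul 2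
  have hM : ∀ (S : Set X) (f g : X → ℝ≥0) (x : X), 2 * OTKernel.shareDensity S f g x ≤ 2 * 2 :=
    fun S f g x => mul_le_mul_right (OTKernel.shareDensity_le x) 2
  set γ₀ : Measure (X × Y) := (2⁻¹ : ℝ≥0∞) • (γ₁ + γ₂) with hγ₀
  have hdens : ∀ h : X → ℝ≥0, γ₀.withDensity (fun z => ((2 * h z.1 : ℝ≥0) : ℝ≥0∞)) =
      (γ₁ + γ₂).withDensity (fun z => (h z.1 : ℝ≥0∞)) := fun h => by
    have : (fun z : X × Y => ((2 * h z.1 : ℝ≥0) : ℝ≥0∞)) =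
        (2 : ℝ≥0∞) • fun z => (h z.1 : ℝ≥0∞) := by
      ext z
      simp
    rw [this, hγ₀, withDensity_smul_measure, withDensity_smul' _ _ ENNReal.ofNat_ne_top, smul_smul,
      ENNReal.inv_mul_cancel two_ne_zero ENNReal.ofNat_ne_top, one_smul]
  have hγ₀_prob : IsProbabilityMeasure γ₀ := ⟨by
    simp [hγ₀, ENNReal.inv_two_add_inv_two]⟩
  obtain ⟨μ₁, hμ₁, hμK₁⟩ := OTKernel.exists_boundedDensity_compProd_eq (γ₀ := γ₀)
    (hm π₁ hf hg) (hM _ f g) (by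
      rw [hdens, hγ₁, hγ₂]
      exact OTKernel.withDensity_shareDensity hdisj₁₂ hdisj₁₃ hdisj₂₃ a b hf hg hf_zero) hX₁
  -- The case of `γ₁` with `π₁, a, f` and `π₃, b, g` exchanged.
  obtain ⟨μ₂, hμ₂, hμK₂⟩ := OTKernel.exists_boundedDensity_compProd_eq (γ₀ := γ₀)
    (hm π₃ hg hf) (hM _ g f) (by
      rw [hdens, add_comm γ₁, hγ₁, hγ₂, add_comm _ (b • π₃), add_comm (a • π₁)]
      exact OTKernel.withDensity_shareDensity hdisj₂₃.symm hdisj₁₃.symm hdisj₁₂.symm b a hg hf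
        hg_zero) hX₂
  refine ⟨γ₀.condKernel, γ₀.fst, μ₁, μ₂, ⟨inferInstance, ?_⟩,
    hcompat.isOptimalTransportKernelOn hc hc_nonneg
      (Measure.isClosed_support.union Measure.isClosed_support) ?_, hμ₁, hμ₂, hμK₁, hμK₂⟩
  · rw [Measure.fst, hγ₀, Measure.map_smul, Measure.map_add _ _ measurable_fst]
    exact (hX₁.2.add_measure hX₂.2).smul_measure (by simp)
  · rw [γ₀.disintegrate, hγ₀, Measure.smul_apply, Measure.add_apply,
      measure_mono_null (Set.compl_subset_compl.2 Set.subset_union_left)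
        Measure.measure_compl_support,
      measure_mono_null (Set.compl_subset_compl.2 Set.subset_union_right)
        Measure.measure_compl_support]
    simp
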